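/- Let $(X,\mathscr A,\mu)$ be a discrete measure space, i.e. $\mathscr A=2^X$, the set $\mathrm{At}(\mu)=\{x\in X:\mu(\{x\})>0\}$ is countable, $\mu(X\setminus \mathrm{At}(\mu))=0$, and $\mu(\{x\})<\infty$ for all $x\in X$. Let $\phi\colon X\to X$ and $w\colon X\to\mathbb C\setminus\{0\}$. For $u\colon X\to\mathbb C$ let $\mu_u(\sigma)=\int_\sigma|u|^2\,d\mu$; if $\mu_u\circ\phi^{-1}\ll\mu$, let $\mathsf h_{\phi,u}=\frac{d(\mu_u\circ\phi^{-1})}{d\mu}\colon X\to[0,\infty]$, and let $C_{\phi,u}$ be the operator in (complex) $L^2(\mu)$ given by $C_{\phi,u}f=u\cdot(f\circ\phi)$ with domain $\{f\in L^2(\mu): u\cdot(f\circ\phi)\in L^2(\mu)\}$. Write $C_\phi=C_{\phi,\mathbf 1}$, $\mathsf h_\phi=\mathsf h_{\phi,\mathbf 1}$ with $\mathbf 1$ the constant function $1$; let $M_w$ be the operator of multiplication by $w$ in $L^2(\mu)$ with its maximal domain; let $\mathsf E_\phi$ be the conditional expectation with respect to the measure $\mu$ and the $\sigma$-algebra $\phi^{-1}(\mathscr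 A)$; and let $\hat w=\frac{w}{\mathsf h_{\phi,w}\circ\phi}$, $\hat{\mathbf 1}=\frac{1}{\mathsf h_\phi\circ\phi}$. Products of operators have their natural maximal domains. For a linear operator $T$ in a Hilbert space with domain $D(T)$, range $R(T)$ and kernel $N(T)$, such that $D(T)=N(T)\oplus(D(T)\cap N(T)^\perp)$, the reciprocal $T^\dagger$ is the unique operator with domain $R(T)\oplus R(T)^\perp$ and kernel $R(T)^\perp$ such that $TT^\dagger f=P_{\overline{R(T)}}f$ for $f\in D(T^\dagger)$ and $T^\dagger Tg=P_{N(T)^\perp}g$ for $g\in D(T)$. Assume that $C_\phi$ and $C_{\phi,w}$ are well-defined (that is, $\mu\circ\phi^{-1}\ll\mu$ and $\mu_w\circ\phi^{-1}\ll\mu$) and densely defined, and that $\mathsf E_\phi(|w|^2)=|w|^2$ a.e. $[\mu]$. Then the following conditions are equivalent: (i) there is a real $\alpha>0$ such that $\alpha<|w|$ a.e. $[\mu]$; (ii) there is a real $\beta>0$ such that $\mathsf h_{\phi,\hat w}\le\beta\,\mathsf h_{\phi,\hat{\mathbf 1}}$ a.e. $[\mu]$. Moreover, if either of these conditions holds,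 then the reciprocals of $M_wC_\phi$, $C_\phi$ and $M_w$ exist and $(M_wC_\phi)^\dagger=C_\phi^\dagger M_w^\dagger$ (equality of operators, including their domains). -/

import Mathlib

open MeasureTheory
open scoped ENNReal

noncomputable section

namespace WeightedComposition

/-! ### Unbounded operators between Hilbert spaces and their reciprocals -/

section Operators

variable {E F G : Type*}
  [NormedAddCommGroup E] [InnerProductSpace ℂ E]
  [NormedAddCommGroup F] [InnerProductSpace ℂ F]
  [NormedAddCommGroup G] [InnerProductSpace ℂ G]

/-- The range `R(T)`. -/
def opRange (T : E →ₗ.[ℂ] F) : Submodule ℂ F := LinearMap.range T.toFun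

/-- The kernel `N(T)`, a subspace of the domain of `T`, regarded as a subspace of `E`. -/
def opKer (T : E →ₗ.[ℂ] F) : Submodule ℂ E := (LinearMap.ker T.toFun).map T.domain.subtype

/-- The product `S T` with its maximal domain `{x ∈ D(T) : T x ∈ D(S)}`. -/
def opMul (S : F →ₗ.[ℂ] G) (T : E →ₗ.[ℂ] F) : E →ₗ.[ℂ] G where
  domain :=
    { carrier := {x | ∃ h : x ∈ T.domain, T ⟨x, h⟩ ∈ S.domain}
      zero_mem' := ⟨T.domain.zero_mem, by
        have h0 : T ⟨0, T.domain.zero_mem⟩ = 0 := T.map_zero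
        rw [h0]; exact S.domain.zero_mem⟩
      add_mem' := by
        rintro a b ⟨ha, ha'⟩ ⟨hb, hb'⟩
        refine ⟨T.domain.add_mem ha hb, ?_⟩
        have h : T ⟨a + b, T.domain.add_mem ha hb⟩ = T ⟨a, ha⟩ + T ⟨b, hb⟩ :=
          T.map_add ⟨a, ha⟩ ⟨b, hb⟩
        rw [h]; exact S.domain.add_mem ha' hb'
      smul_mem' := by
        rintro c a ⟨ha, ha'⟩
        refine ⟨T.domain.smul_mem c ha, ?_⟩
        have h : T ⟨c • a, T.domain.smul_mem c ha⟩ = c • T ⟨a, ha⟩ := T.map_smul c ⟨a, ha⟩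
        rw [h]; exact S.domain.smul_mem c ha' }
  toFun :=
    { toFun := fun x => S ⟨T ⟨x.1, x.2.1⟩, x.2.2⟩
      map_add' := by
        intro x y
        rw [← S.map_add]
        congr 1
        exact Subtype.ext (T.map_add ⟨x.1, x.2.1⟩ ⟨y.1, y.2.1⟩)
      map_smul' := by
        intro c x
        rw [RingHom.id_apply, ← S.map_smul]
        congr 1
        exact Subtype.ext (T.map_smul c ⟨x.1, x.2.1⟩) }

/-- The condition `D(T) = N(T) ⊕ (D(T) ∩ N(T)^⊥)` under which the reciprocal of `T` exists. -/
def HasReciprocal (T : E →ₗ.[ℂ] F) : Prop :=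
  T.domain = opKer T ⊔ (T.domain ⊓ (opKer T)ᗮ)

/-- `S` is a reciprocal of `T`: `D(S) = R(T) ⊕ R(T)^⊥`, `T S` is the orthogonal projection onto the
closure of `R(T)` on `D(S)`, `S T` is the orthogonal projection onto `N(T)^⊥` on `D(T)`, and
`N(S) = R(T)^⊥`. -/
structure IsReciprocal [CompleteSpace E] [CompleteSpace F]
    (T : E →ₗ.[ℂ] F) (S : F →ₗ.[ℂ] E) : Prop where
  domain_eq : S.domain = opRange T ⊔ (opRange T)ᗮ
  apply_apply : ∀ f : S.domain, ∃ h : S f ∈ T.domain,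
    T ⟨S f, h⟩ = (opRange T).topologicalClosure.starProjection (f : F)
  apply_apply' : ∀ g : T.domain, ∃ h : T g ∈ S.domain,
    S ⟨T g, h⟩ = (opKer T)ᗮ.starProjection (g : E)
  ker_eq : opKer S = (opRange T)ᗮ

/-- The graph of the reciprocal: all pairs `(T g + h, g)` with `g ∈ D(T) ∩ N(T)^⊥` and
`h ∈ R(T)^⊥`. -/
def reciprocalGraph (T : E →ₗ.[ℂ] F) : Submodule ℂ (F × E) where
  carrier := {p | ∃ g : T.domain, (g : E) ∈ (opKer T)ᗮ ∧ p.2 = g ∧ p.1 - T g ∈ (opRange T)ᗮ}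
  zero_mem' := ⟨0, by simp, by simp, by simp⟩
  add_mem' := by
    rintro a b ⟨g, hg, hg2, hg1⟩ ⟨k, hk, hk2, hk1⟩
    refine ⟨g + k, Submodule.add_mem _ hg hk, by simp [hg2, hk2], ?_⟩
    have : (a + b).1 - T (g + k) = (a.1 - T g) + (b.1 - T k) := by
      rw [T.map_add, Prod.fst_add]; abel
    rw [this]; exact Submodule.add_mem _ hg1 hk1
  smul_mem' := by
    rintro c a ⟨g, hg, hg2, hg1⟩
    refine ⟨c • g, Submodule.smul_mem _ c hg, by simp [hg2], ?_⟩
    have : (c • a).1 - T (c • g) = c • (a.1 - T g) := by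
      rw [T.map_smul, Prod.smul_fst, smul_sub]
    rw [this]; exact Submodule.smul_mem _ c hg1

/-- The reciprocal `T†`. -/
def reciprocal (T : E →ₗ.[ℂ] F) : F →ₗ.[ℂ] E := (reciprocalGraph T).toLinearPMap

theorem mem_opKer {T : E →ₗ.[ℂ] F} {x : E} :
    x ∈ opKer T ↔ ∃ h : x ∈ T.domain, T ⟨x, h⟩ = 0 := by
  simp only [opKer, Submodule.mem_map, LinearMap.mem_ker, Submodule.subtype_apply, Subtype.exists,
    exists_and_right, exists_eq_right]
  rfl

theorem apply_mem_opRange (T : E →ₗ.[ℂ] F) (g : T.domain) : T g ∈ opRange T := ⟨g, rfl⟩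

theorem graph_reciprocal (T : E →ₗ.[ℂ] F) : (reciprocal T).graph = reciprocalGraph T := by
  refine Submodule.toLinearPMap_graph_eq _ ?_
  rintro ⟨f, g'⟩ ⟨g, hg, hg2, hg1⟩ (hf : f = 0)
  have hg2' : g' = g := hg2
  have hg1' : f - T g ∈ (opRange T)ᗮ := hg1
  rw [hf, zero_sub, Submodule.neg_mem_iff] at hg1'
  have h0 : T g = 0 :=
    (Submodule.orthogonal_disjoint (opRange T)).le_bot ⟨apply_mem_opRange T g, hg1'⟩
  have h1 : (g : E) = 0 :=
    (Submodule.orthogonal_disjoint (opKer T)).le_bot ⟨mem_opKer.2 ⟨g.2, h0⟩, hg⟩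
  exact hg2'.trans h1

/-- The reciprocal satisfies its defining properties whenever it exists. -/
theorem isReciprocal_reciprocal [CompleteSpace E] [CompleteSpace F] (T : E →ₗ.[ℂ] F)
    (hT : HasReciprocal T) : IsReciprocal T (reciprocal T) := by
  have key : ∀ {f : F} {g : E}, (f, g) ∈ (reciprocal T).graph ↔
      ∃ k : T.domain, (k : E) ∈ (opKer T)ᗮ ∧ g = k ∧ f - T k ∈ (opRange T)ᗮ := by
    intro f g; rw [graph_reciprocal]; rfl
  have val : ∀ {f : F} {g : E}, (f, g) ∈ (reciprocal T).graph →
      ∃ h : f ∈ (reciprocal T).domain, reciprocal T ⟨f, h⟩ = g := by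
    intro f g h
    have hf := LinearPMap.mem_domain_of_mem_graph h
    exact ⟨hf, ((LinearPMap.image_iff hf).2 h).symm⟩
  have dec : ∀ g : T.domain, ∃ k : T.domain, (k : E) ∈ (opKer T)ᗮ ∧ T k = T g ∧
      (g : E) - k ∈ opKer T := by
    intro g
    have hg : (g : E) ∈ opKer T ⊔ (T.domain ⊓ (opKer T)ᗮ) := hT ▸ g.2
    obtain ⟨a, ha, b, hb, hab⟩ := Submodule.mem_sup.1 hg
    obtain ⟨had, ha0⟩ := mem_opKer.1 ha
    refine ⟨⟨b, hb.1⟩, hb.2, ?_, ?_⟩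
    · have : g = ⟨a, had⟩ + ⟨b, hb.1⟩ := Subtype.ext hab.symm
      rw [this, T.map_add, ha0, zero_add]
    · rw [← hab]; simpa using ha
  refine ⟨?_, ?_, ?_, ?_⟩
  · ext f
    rw [LinearPMap.mem_domain_iff, Submodule.mem_sup]
    constructor
    · rintro ⟨g, hg⟩
      obtain ⟨k, -, -, hk⟩ := key.1 hg
      exact ⟨T k, apply_mem_opRange T k, _, hk, by abel⟩
    · rintro ⟨_, ⟨g, rfl⟩, h, hh, rfl⟩
      obtain ⟨k, hk, hkg, -⟩ := dec g
      refine ⟨k, key.2 ⟨k, hk, rfl, ?_⟩⟩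
      change T g + h - T k ∈ _
      rw [hkg]; simpa using hh
  · intro f
    obtain ⟨k, -, hk2, hk1⟩ := key.1 ((reciprocal T).mem_graph f)
    have hd : reciprocal T f ∈ T.domain := hk2 ▸ k.2
    refine ⟨hd, ?_⟩
    have : (⟨reciprocal T f, hd⟩ : T.domain) = k := Subtype.ext hk2
    rw [this]
    refine (Submodule.eq_starProjection_of_mem_orthogonal
      ((opRange T).le_topologicalClosure (apply_mem_opRange T k)) ?_).symm
    rwa [Submodule.orthogonal_closure]
  · intro g
    obtain ⟨k, hk, hkg, hgk⟩ := dec g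
    obtain ⟨h, hv⟩ := val (key.2 ⟨k, hk, rfl, by rw [hkg, sub_self]; exact Submodule.zero_mem _⟩ :
      (T g, (k : E)) ∈ (reciprocal T).graph)
    refine ⟨h, hv.trans ?_⟩
    refine (Submodule.eq_starProjection_of_mem_orthogonal hk ?_).symm
    exact (Submodule.le_orthogonal_orthogonal _) hgk
  · ext f
    rw [mem_opKer]
    constructor
    · rintro ⟨hf, h0⟩
      obtain ⟨k, -, hk2, hk1⟩ := key.1 ((reciprocal T).mem_graph ⟨f, hf⟩)
      have hk0 : k = 0 := Subtype.ext (hk2.symm.trans h0)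
      rw [hk0, T.map_zero] at hk1
      simpa using hk1
    · intro hf
      exact val (key.2 ⟨0, by simp, by simp, by simpa using hf⟩)

/-- The defining properties determine the reciprocal. -/
theorem IsReciprocal.unique [CompleteSpace E] [CompleteSpace F] {T : E →ₗ.[ℂ] F}
    {S S' : F →ₗ.[ℂ] E} (h : IsReciprocal T S) (h' : IsReciprocal T S') : S = S' := by
  have hd : S.domain = S'.domain := h.domain_eq.trans h'.domain_eq.symm
  refine LinearPMap.ext hd ?_
  intro f hf hf'
  have hm := hf
  rw [h.domain_eq] at hm
  obtain ⟨_, ⟨g, rfl⟩, u, hu, rfl⟩ := Submodule.mem_sup.1 hm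
  obtain ⟨a, ha⟩ := h.apply_apply' g
  obtain ⟨b, hb⟩ := h'.apply_apply' g
  obtain ⟨c, hc⟩ := mem_opKer.1 (h.ker_eq ▸ hu)
  obtain ⟨d, hd'⟩ := mem_opKer.1 (h'.ker_eq ▸ hu)
  have e1 := S.map_add ⟨T g, a⟩ ⟨u, c⟩
  have e2 := S'.map_add ⟨T g, b⟩ ⟨u, d⟩
  rw [ha, hc] at e1
  rw [hb, hd'] at e2
  exact e1.trans e2.symm

end Operators

/-! ### Weighted composition operators in `L²(μ)` -/

section Composition

variable {X : Type*} [MeasurableSpace X]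

/-- `(X, 𝒜, μ)` is a discrete measure space: `𝒜 = 2^X`, `μ` has countably many atoms (points of
positive mass), it is concentrated on them, and points have finite mass. -/
structure IsDiscreteMeasureSpace (μ : Measure X) : Prop where
  measurableSet_all : ∀ s : Set X, MeasurableSet s
  countable_atoms : {x | 0 < μ {x}}.Countable
  measure_compl_atoms : μ {x | 0 < μ {x}}ᶜ = 0
  measure_singleton_lt_top : ∀ x, μ {x} < ∞

/-- The measure `μ_w`, `μ_w(σ) = ∫_σ |w|² dμ`. -/
def weightedMeasure (μ : Measure X) (w : X → ℂ) : Measure X :=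
  μ.withDensity fun x => ‖w x‖ₑ ^ 2

/-- The operator `C_{φ,w}` is well-defined: `φ` and `w` are measurable and `μ_w ∘ φ⁻¹` is
absolutely continuous with respect to `μ`. -/
structure IsWellDefined (μ : Measure X) (φ : X → X) (w : X → ℂ) : Prop where
  measurable_map : Measurable φ
  measurable_weight : Measurable w
  absolutelyContinuous : (weightedMeasure μ w).map φ ≪ μ

theorem IsWellDefined.ae {μ : Measure X} {φ : X → X} {w : X → ℂ} (h : IsWellDefined μ φ w)
    {p : X → Prop} (hp : ∀ᵐ x ∂μ, p x) : ∀ᵐ x ∂μ, w x ≠ 0 → p (φ x) := by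
  have h1 : ∀ᵐ x ∂((weightedMeasure μ w).map φ), p x := h.absolutelyContinuous.ae_le hp
  have h2 := ae_of_ae_map h.measurable_map.aemeasurable h1
  rw [weightedMeasure, ae_withDensity_iff (h.measurable_weight.enorm.pow_const 2)] at h2
  filter_upwards [h2] with x hx hw
  exact hx (by simpa using hw)

theorem IsWellDefined.add_ae {μ : Measure X} {φ : X → X} {w : X → ℂ} (h : IsWellDefined μ φ w)
    (f g : Lp ℂ 2 μ) : (fun x => w x * (f + g : Lp ℂ 2 μ) (φ x)) =ᵐ[μ]
      (fun x => w x * f (φ x)) + fun x => w x * g (φ x) := by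
  filter_upwards [h.ae (Lp.coeFn_add f g)] with x hx
  by_cases hw : w x = 0
  · simp [hw]
  · have hx' := hx hw
    rw [Pi.add_apply] at hx'
    rw [Pi.add_apply, hx', mul_add]

theorem IsWellDefined.smul_ae {μ : Measure X} {φ : X → X} {w : X → ℂ} (h : IsWellDefined μ φ w)
    (c : ℂ) (f : Lp ℂ 2 μ) : (fun x => w x * (c • f : Lp ℂ 2 μ) (φ x)) =ᵐ[μ]
      c • fun x => w x * f (φ x) := by
  filter_upwards [h.ae (Lp.coeFn_smul c f)] with x hx
  by_cases hw : w x = 0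
  · simp [hw]
  · simp [hx hw, mul_left_comm]

theorem IsWellDefined.zero_ae {μ : Measure X} {φ : X → X} {w : X → ℂ} (h : IsWellDefined μ φ w) :
    (fun x => w x * (0 : Lp ℂ 2 μ) (φ x)) =ᵐ[μ] (0 : X → ℂ) := by
  filter_upwards [h.ae (Lp.coeFn_zero ℂ 2 μ)] with x hx
  by_cases hw : w x = 0
  · simp [hw]
  · have hx' := hx hw
    rw [Pi.zero_apply] at hx'
    rw [Pi.zero_apply, hx', mul_zero]

/-- The weighted composition operator `C_{φ,w} f = w · (f ∘ φ)` in `L²(μ)` with domain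
`{f ∈ L²(μ) : w · (f ∘ φ) ∈ L²(μ)}`. -/
def weightedComp (μ : Measure X) (φ : X → X) (w : X → ℂ) (h : IsWellDefined μ φ w) :
    Lp ℂ 2 μ →ₗ.[ℂ] Lp ℂ 2 μ where
  domain :=
    { carrier := {f | MemLp (fun x => w x * f (φ x)) 2 μ}
      zero_mem' := (memLp_congr_ae h.zero_ae).2 MemLp.zero
      add_mem' := fun {f g} hf hg => (memLp_congr_ae (h.add_ae f g)).2 (MemLp.add hf hg)
      smul_mem' := fun c f hf => (memLp_congr_ae (h.smul_ae c f)).2 (MemLp.const_smul hf c) }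
  toFun :=
    { toFun := fun f => MemLp.toLp (fun x => w x * (f : Lp ℂ 2 μ) (φ x)) f.2
      map_add' := fun f g => by
        rw [← MemLp.toLp_add]
        exact MemLp.toLp_congr _ _ (h.add_ae f g)
      map_smul' := fun c f => by
        rw [RingHom.id_apply, ← MemLp.toLp_const_smul]
        exact MemLp.toLp_congr _ _ (h.smul_ae c f) }

theorem isWellDefined_id (μ : Measure X) {w : X → ℂ} (hw : Measurable w) :
    IsWellDefined μ id w :=
  ⟨measurable_id, hw, by
    rw [Measure.map_id]; exact withDensity_absolutelyContinuous _ _⟩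

/-- The multiplication operator `M_w f = w · f` in `L²(μ)` with domain
`{f ∈ L²(μ) : w · f ∈ L²(μ)}`. -/
def mulOp (μ : Measure X) (w : X → ℂ) (hw : Measurable w) : Lp ℂ 2 μ →ₗ.[ℂ] Lp ℂ 2 μ :=
  weightedComp μ id w (isWellDefined_id μ hw)

/-- The Radon-Nikodym derivative `h_{φ,w} = d(μ_w ∘ φ⁻¹)/dμ`, with values in `[0, ∞]`. -/
def rn (μ : Measure X) (φ : X → X) (w : X → ℂ) : X → ℝ≥0∞ :=
  ((weightedMeasure μ w).map φ).rnDeriv μ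

/-- The weight `w / (h_{φ,w} ∘ φ)`. For a well-defined `C_{φ,w}` one has `h_{φ,w} ∘ φ > 0` almost
everywhere on `{w ≠ 0}`, so the value of the quotient at `h_{φ,w} ∘ φ = 0` is immaterial. -/
def hatWeight (μ : Measure X) (φ : X → X) (w : X → ℂ) : X → ℂ :=
  fun x => w x / ((rn μ φ w (φ x)).toReal : ℂ)

/-- The conditional expectation `E_{φ,w}(f)` of a `[0, ∞]`-valued function with respect to the
`σ`-algebra `φ⁻¹(𝒜)` and the measure `μ_w`. -/
def condExpect (μ : Measure X) (φ : X → X) (w : X → ℂ) (f : X → ℝ≥0∞) : X → ℝ≥0∞ :=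
  condLExp (MeasurableSpace.comap φ inferInstance) (weightedMeasure μ w) f

end Composition

end WeightedComposition

end

namespace WeightedComposition

/-! ### Graphs of products and reciprocals; square integrability and fibre means -/

section Preliminaries

/-! Everything happens on the fibres `φ ⁻¹' {y}` over atoms `y`. The hypothesis on the conditional
expectation says that `|w| = c ∘ φ` a.e. (`exists_norm_eq_comp`), and dense definiteness makes the
fibres over atoms finite for `μ` and `μ_w` (`weightedMeasure_fiber_lt_top`).

For the equivalence, `h_{φ,w} = c² h_φ` on atoms, so `|ŵ| = |w|⁻¹ |1̂|`. On a fibre of positive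
measure, comparing the two derivatives therefore amounts to `c(y)⁻² ≤ β`.

For the reciprocals, graphs are compared. When `|w| > α`, `M_w C_φ` is `C_{φ,w}` with the same
domain, and `M_w†` divides by `w`. Orthogonality to the range of `C_{φ,u}` means that all fibre
integrals of `f ū` vanish; for `f = w k` and `u = w` these are `c(y)²` times the fibre integrals of
`k`. Hence `(f, g)` satisfies the orthogonality conditions for `C_{φ,w}` exactly when `(k, g)` does
for `C_φ`. The domains match as well: the lower bound on `|w|` gives one inclusion, and for the
other `g ∘ φ` is the fibre mean of `k`, so Cauchy–Schwarz on each fibre bounds `w · (g ∘ φ)` by `w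
k` in norm (`mem_domain_of_sub_mem_orthogonal`). -/

theorem mem_graph_opMul {E F G : Type*}
    [NormedAddCommGroup E] [InnerProductSpace ℂ E]
    [NormedAddCommGroup F] [InnerProductSpace ℂ F]
    [NormedAddCommGroup G] [InnerProductSpace ℂ G]
    {S : F →ₗ.[ℂ] G} {T : E →ₗ.[ℂ] F} {x : E} {z : G} :
    (x, z) ∈ (opMul S T).graph ↔ ∃ y, (x, y) ∈ T.graph ∧ (y, z) ∈ S.graph := by
  simp only [LinearPMap.mem_graph_iff]
  constructor
  · rintro ⟨⟨a, ha, hb⟩, rfl, rfl⟩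
    exact ⟨T ⟨a, ha⟩, ⟨⟨a, ha⟩, rfl, rfl⟩, ⟨⟨_, hb⟩, rfl, rfl⟩⟩
  · rintro ⟨y, ⟨⟨a, ha⟩, rfl, rfl⟩, ⟨⟨b, hb⟩, hb', rfl⟩⟩
    obtain rfl : b = T ⟨a, ha⟩ := hb'
    exact ⟨⟨a, ha, hb⟩, rfl, rfl⟩

theorem mem_graph_reciprocal {E F : Type*}
    [NormedAddCommGroup E] [InnerProductSpace ℂ E]
    [NormedAddCommGroup F] [InnerProductSpace ℂ F] {T : E →ₗ.[ℂ] F} {f : F} {g : E} :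
    (f, g) ∈ (reciprocal T).graph ↔
      ∃ h : g ∈ T.domain, g ∈ (opKer T)ᗮ ∧ f - T ⟨g, h⟩ ∈ (opRange T)ᗮ := by
  rw [graph_reciprocal]
  constructor
  · rintro ⟨⟨k, hk⟩, h1, h2, h3⟩
    obtain rfl : g = k := h2
    exact ⟨hk, h1, h3⟩
  · rintro ⟨h, h1, h2⟩
    exact ⟨⟨g, h⟩, h1, rfl, h2⟩

variable {X : Type*} [MeasurableSpace X] {μ : Measure X} {φ : X → X} {u : X → ℂ}

theorem memLp_two_iff_lintegral {F : X → ℂ} (hF : AEStronglyMeasurable F μ) :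
    MemLp F 2 μ ↔ ∫⁻ x, ‖F x‖ₑ ^ 2 ∂μ < ∞ := by
  have := eLpNorm_lt_top_iff_lintegral_rpow_enorm_lt_top (f := F) (μ := μ) (p := 2)
    (by simp) (by simp)
  simp only [ENNReal.toReal_ofNat, ENNReal.rpow_ofNat] at this
  rw [← this]
  exact ⟨fun h => h.2, fun h => ⟨hF, h⟩⟩

/-- The mean of a square integrable function over a finite measure has at most its norm. -/
theorem lintegral_const_le_of_integral_sub_eq_zero [IsFiniteMeasure μ] {k : X → ℂ}
    (hk : MemLp k 2 μ) {a : ℂ} (ha : ∫ x, (k x - a) ∂μ = 0) :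
    ∫⁻ _, ‖a‖ₑ ^ 2 ∂μ ≤ ∫⁻ x, ‖k x‖ₑ ^ 2 ∂μ := by
  have hki : Integrable k μ := hk.integrable (by norm_num)
  rw [integral_sub hki (integrable_const a), sub_eq_zero, integral_const] at ha
  rw [lintegral_const]
  set m := μ Set.univ with hm
  have hmt : m ≠ ∞ := measure_ne_top _ _
  rcases eq_or_ne m 0 with h0 | h0
  · simp [h0]
  have h1 : ‖a‖ₑ * m ≤ ∫⁻ x, ‖k x‖ₑ ∂μ := by
    refine le_trans (le_of_eq ?_) (enorm_integral_le_lintegral_enorm k)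
    rw [ha, enorm_smul, mul_comm, Real.enorm_eq_ofReal measureReal_nonneg,
      ofReal_measureReal]
  -- Hölder bounds the `L¹` norm by `m ^ (1/2)` times the `L²` norm; squaring `‖a‖ m ≤ ‖k‖₁` and
  -- cancelling one factor `m` gives the claim.
  have h2 := eLpNorm_le_eLpNorm_mul_rpow_measure_univ (p := 1) (q := 2) (μ := μ) (f := k)
    (by norm_num) hk.1
  rw [eLpNorm_one_eq_lintegral_enorm,
    eLpNorm_eq_lintegral_rpow_enorm_toReal (by simp) (by simp)] at h2
  simp only [ENNReal.toReal_ofNat, ENNReal.rpow_ofNat, ENNReal.toReal_one] at h2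
  rw [← hm, show (1 / 1 - 1 / 2 : ℝ) = 1 / 2 by norm_num] at h2
  have h3 := pow_le_pow_left' (h1.trans h2) 2
  have hs : ∀ t : ℝ≥0∞, (t ^ (1 / 2 : ℝ)) ^ 2 = t := fun t => by
    rw [← ENNReal.rpow_natCast, ← ENNReal.rpow_mul]; norm_num
  rw [mul_pow, mul_pow, hs, hs, sq m, ← mul_assoc] at h3
  exact (ENNReal.mul_le_mul_iff_left h0 hmt).1 h3

theorem coeFn_weightedComp (h : IsWellDefined μ φ u) (f : (weightedComp μ φ u h).domain) :
    weightedComp μ φ u h f =ᵐ[μ] fun x => u x * (f : Lp ℂ 2 μ) (φ x) :=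
  MemLp.coeFn_toLp f.2

theorem mem_domain_weightedComp (h : IsWellDefined μ φ u) (f : Lp ℂ 2 μ) :
    f ∈ (weightedComp μ φ u h).domain ↔ MemLp (fun x => u x * f (φ x)) 2 μ := Iff.rfl

theorem mem_opKer_weightedComp (h : IsWellDefined μ φ u) {f : Lp ℂ 2 μ} :
    f ∈ opKer (weightedComp μ φ u h) ↔ ∀ᵐ x ∂μ, u x * f (φ x) = 0 := by
  rw [mem_opKer]
  constructor
  · rintro ⟨hf, h0⟩
    have := coeFn_weightedComp h ⟨f, hf⟩
    rw [h0] at this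
    filter_upwards [this, Lp.coeFn_zero ℂ 2 μ] with x hx hx0
    rw [← hx, hx0]; rfl
  · intro hf
    have hf' : (fun x => u x * f (φ x)) =ᵐ[μ] (0 : X → ℂ) := hf
    have hd : f ∈ (weightedComp μ φ u h).domain := (memLp_congr_ae hf').2 MemLp.zero
    exact ⟨hd, Lp.ext ((coeFn_weightedComp h ⟨f, hd⟩).trans
      (hf'.trans (Lp.coeFn_zero ℂ 2 μ).symm))⟩

theorem weightedMeasure_one : weightedMeasure μ 1 = μ := by
  simp [weightedMeasure]

end Preliminaries

/-! ### Atoms, fibre decompositions and Radon–Nikodym derivatives at points -/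

namespace IsDiscreteMeasureSpace

variable {X : Type*} [MeasurableSpace X] {μ : Measure X} {φ : X → X} {u : X → ℂ}

theorem measurable {Y : Type*} [MeasurableSpace Y] (hμ : IsDiscreteMeasureSpace μ) (f : X → Y) :
    Measurable f := fun _ _ => hμ.measurableSet_all _

theorem ae_iff (hμ : IsDiscreteMeasureSpace μ) {p : X → Prop} :
    (∀ᵐ x ∂μ, p x) ↔ ∀ x, 0 < μ {x} → p x := by
  constructor
  · intro h x hx
    by_contra hp
    have : μ {x} ≤ μ {x | ¬ p x} := measure_mono (by simpa using hp)
    rw [MeasureTheory.ae_iff.1 h] at this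
    exact absurd this (not_le.2 hx)
  · intro h
    refine measure_mono_null (fun x hx => ?_) hμ.measure_compl_atoms
    exact fun hx' => hx (h x hx')

theorem sigmaFinite (hμ : IsDiscreteMeasureSpace μ) : SigmaFinite μ := by
  refine Measure.sigmaFinite_of_countable
    (S := insert {x | 0 < μ {x}}ᶜ ((fun x => {x}) '' {x | 0 < μ {x}}))
    ((hμ.countable_atoms.image _).insert _) ?_ ?_
  · rintro s (rfl | ⟨x, -, rfl⟩)
    · rw [hμ.measure_compl_atoms]; exact ENNReal.zero_lt_top
    · exact hμ.measure_singleton_lt_top x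
  · refine Set.eq_univ_of_forall fun x => ?_
    by_cases hx : 0 < μ {x}
    · exact ⟨{x}, Or.inr ⟨x, hx, rfl⟩, rfl⟩
    · exact ⟨_, Or.inl rfl, hx⟩

/-- Almost every point is an atom, and absolute continuity pulls this back along `φ` wherever `u ≠
0`. -/
theorem atom_map (hμ : IsDiscreteMeasureSpace μ) (h : IsWellDefined μ φ u) {x : X}
    (hx : 0 < μ {x}) (hu : u x ≠ 0) : 0 < μ {φ x} := by
  have := h.ae (p := fun y => 0 < μ {y}) ((hμ.ae_iff).2 fun _ h => h)
  exact hμ.ae_iff.1 this x hx hu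

theorem lintegral_eq_tsum_fiber (hμ : IsDiscreteMeasureSpace μ)
    (hφ : ∀ᵐ x ∂μ, 0 < μ {φ x}) (F : X → ℝ≥0∞) :
    ∫⁻ x, F x ∂μ = ∑' y : {y | 0 < μ {y}}, ∫⁻ x in φ ⁻¹' {(y : X)}, F x ∂μ := by
  have : Countable {y | 0 < μ {y}} := hμ.countable_atoms
  rw [← lintegral_iUnion (fun _ => hμ.measurableSet_all _), Measure.restrict_eq_self_of_ae_mem]
  · filter_upwards [hφ] with x hx
    exact Set.mem_iUnion.2 ⟨⟨φ x, hx⟩, rfl⟩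
  · intro a b hab
    refine Set.disjoint_left.2 fun x hx hx' => hab (Subtype.ext ?_)
    exact (Set.mem_singleton_iff.1 hx).symm.trans hx'

theorem integral_eq_zero_of_fiber (hμ : IsDiscreteMeasureSpace μ)
    (hφ : ∀ᵐ x ∂μ, 0 < μ {φ x}) {F : X → ℂ} (hF : Integrable F μ)
    (h0 : ∀ y, 0 < μ {y} → ∫ x in φ ⁻¹' {y}, F x ∂μ = 0) : ∫ x, F x ∂μ = 0 := by
  have : Countable {y | 0 < μ {y}} := hμ.countable_atoms
  have hs : μ.restrict (⋃ y : {y | 0 < μ {y}}, φ ⁻¹' {(y : X)}) = μ := by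
    refine Measure.restrict_eq_self_of_ae_mem ?_
    filter_upwards [hφ] with x hx
    exact Set.mem_iUnion.2 ⟨⟨φ x, hx⟩, rfl⟩
  rw [← hs, integral_iUnion (fun _ => hμ.measurableSet_all _) ?_ hF.integrableOn]
  · exact (tsum_congr fun y : {y | 0 < μ {y}} => h0 y y.2).trans tsum_zero
  · intro a b hab
    refine Set.disjoint_left.2 fun x hx hx' => hab (Subtype.ext ?_)
    exact (Set.mem_singleton_iff.1 hx).symm.trans hx'

theorem weightedMeasure_apply (hμ : IsDiscreteMeasureSpace μ) (u : X → ℂ) (s : Set X) :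
    weightedMeasure μ u s = ∫⁻ x in s, ‖u x‖ₑ ^ 2 ∂μ :=
  withDensity_apply _ (hμ.measurableSet_all _)

/-- The Radon–Nikodym identity evaluated on a singleton. Since `μ_u ≪ μ`, absolute continuity for
the weight 1 suffices for every `u`, in particular for the hat weights. -/
theorem rn_mul_measure (hμ : IsDiscreteMeasureSpace μ) (h1 : μ.map φ ≪ μ) (u : X → ℂ) (y : X) :
    rn μ φ u y * μ {y} = ∫⁻ x in φ ⁻¹' {y}, ‖u x‖ₑ ^ 2 ∂μ := by
  have := hμ.sigmaFinite
  have : MeasurableSingletonClass X := ⟨fun _ => hμ.measurableSet_all _⟩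
  have hu : SFinite (weightedMeasure μ u) := by unfold weightedMeasure; infer_instance
  have hac : (weightedMeasure μ u).map φ ≪ μ :=
    ((withDensity_absolutelyContinuous _ _).map (hμ.measurable φ)).trans h1
  have key := Measure.withDensity_rnDeriv_eq _ _ hac
  rw [← lintegral_singleton, ← hμ.weightedMeasure_apply u,
    ← Measure.map_apply (hμ.measurable φ) (hμ.measurableSet_all _)]
  conv_rhs => rw [← key]
  rw [withDensity_apply _ (hμ.measurableSet_all _)]
  rfl

/-- The indicator of a point, as an element of `L²`. -/
noncomputable def point (hμ : IsDiscreteMeasureSpace μ) (y : X) : Lp ℂ 2 μ :=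
  indicatorConstLp 2 (hμ.measurableSet_all {y}) (hμ.measure_singleton_lt_top y).ne 1

theorem point_ae (hμ : IsDiscreteMeasureSpace μ) (y : X) :
    hμ.point y =ᵐ[μ] Set.indicator {y} fun _ => 1 := indicatorConstLp_coeFn

/-- `μ_u` is finite on fibres over atoms when `C_{φ,u}` is densely defined. -/
theorem weightedMeasure_fiber_lt_top (hμ : IsDiscreteMeasureSpace μ) (h : IsWellDefined μ φ u)
    (hd : Dense ((weightedComp μ φ u h).domain : Set (Lp ℂ 2 μ))) {y : X} (hy : 0 < μ {y}) :
    weightedMeasure μ u (φ ⁻¹' {y}) < ∞ := by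
  by_contra htop
  have hp : hμ.point y = 0 := by
    refine hd.eq_zero_of_inner_left ℂ fun f hf => ?_
    have hfin := (memLp_two_iff_lintegral (hμ.measurable _).aestronglyMeasurable).1
      ((mem_domain_weightedComp h f).1 hf)
    have hfy : f y = 0 := by
      by_contra hne
      -- On the fibre `f ∘ φ` is the constant `f y`, so an infinite fibre forces every `f` in the
      -- domain to vanish at `y`. The indicator of `y` is then orthogonal to a dense set.
      have hle : weightedMeasure μ u (φ ⁻¹' {y}) * ‖f y‖ₑ ^ 2 ≤
          ∫⁻ x, ‖u x * f (φ x)‖ₑ ^ 2 ∂μ := by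
        rw [hμ.weightedMeasure_apply, ← lintegral_mul_const _ (hμ.measurable _)]
        refine le_trans (le_of_eq ?_) (setLIntegral_le_lintegral (φ ⁻¹' {y}) _)
        refine setLIntegral_congr_fun (hμ.measurableSet_all _) fun x hx => ?_
        have hx' : φ x = y := hx
        simp only [hx', enorm_mul, mul_pow]
      rw [not_lt_top_iff.1 htop, ENNReal.top_mul (by simpa using hne)] at hle
      exact absurd hfin (not_lt.2 hle)
    rw [L2.inner_def]
    refine integral_eq_zero_of_ae ?_
    filter_upwards [hμ.point_ae y] with x hx
    rw [hx]
    by_cases hxy : x = y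
    · rw [hxy, hfy]; simp
    · simp [hxy]
  have := hμ.ae_iff.1 (hμ.point_ae y) y hy
  rw [hp, hμ.ae_iff.1 (Lp.coeFn_zero ℂ 2 μ) y hy] at this
  simp at this

end IsDiscreteMeasureSpace

end WeightedComposition

/-! ### Kernels, ranges and reciprocals of weighted composition operators -/

namespace WeightedComposition

namespace IsDiscreteMeasureSpace

variable {X : Type*} [MeasurableSpace X] {μ : Measure X} {φ : X → X} {u : X → ℂ}

/-- The operator only sees values on the image `S` under `φ` of the atoms with `u ≠ 0`. Cutting `f`
off to `S` leaves a remainder in the kernel, while kernel elements vanish at the atoms in `S` and so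
are orthogonal to the cut-off. -/
theorem hasReciprocal_weightedComp (hμ : IsDiscreteMeasureSpace μ) (h : IsWellDefined μ φ u) :
    HasReciprocal (weightedComp μ φ u h) := by
  refine le_antisymm (fun f hf => ?_)
    (sup_le (fun f hf => (mem_opKer.1 hf).1) inf_le_left)
  set S : Set X := {y | ∃ x, 0 < μ {x} ∧ u x ≠ 0 ∧ φ x = y}
  have hb : MemLp (S.indicator (f : X → ℂ)) 2 μ :=
    (Lp.memLp f).indicator (hμ.measurableSet_all S)
  have hbS : ∀ y, 0 < μ {y} → (hb.toLp : X → ℂ) y = S.indicator (f : X → ℂ) y := hμ.ae_iff.1 hb.coeFn_toLp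
  have hker : f - hb.toLp ∈ opKer (weightedComp μ φ u h) := by
    refine (mem_opKer_weightedComp h).2 (hμ.ae_iff.2 fun x hx => ?_)
    by_cases hu : u x = 0
    · rw [hu, zero_mul]
    have hy := hμ.atom_map h hx hu
    have hS : φ x ∈ S := ⟨x, hx, hu, rfl⟩
    rw [hμ.ae_iff.1 (Lp.coeFn_sub f hb.toLp) _ hy, Pi.sub_apply, hbS _ hy,
      Set.indicator_of_mem hS, sub_self, mul_zero]
  refine Submodule.mem_sup.2 ⟨f - hb.toLp, hker, hb.toLp, ⟨?_, ?_⟩, sub_add_cancel _ _⟩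
  · have := Submodule.sub_mem _ hf (mem_opKer.1 hker).1
    rwa [sub_sub_cancel] at this
  · refine (Submodule.mem_orthogonal _ _).2 ?_
    intro n hn
    rw [mem_opKer_weightedComp, hμ.ae_iff] at hn
    rw [L2.inner_def]
    refine integral_eq_zero_of_ae (hμ.ae_iff.2 fun y hy => ?_)
    beta_reduce
    rw [hbS y hy]
    by_cases hS : y ∈ S
    · obtain ⟨x, hx, hu, rfl⟩ := hS
      rw [(mul_eq_zero.1 (hn x hx)).resolve_left hu, inner_zero_left]; rfl
    · rw [Set.indicator_of_notMem hS, inner_zero_right]; rfl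

/-- Finiteness of the fibres puts the indicator of an atom `y` in the domain, and its image `u ·
1_{φ⁻¹{y}}` tests the fibre integral. Conversely, `g ∘ φ` is constant on each fibre and comes out of
the integral. -/
theorem mem_orthogonal_opRange_weightedComp (hμ : IsDiscreteMeasureSpace μ)
    (h : IsWellDefined μ φ u) (hu : ∀ x, u x ≠ 0)
    (hfin : ∀ y, 0 < μ {y} → weightedMeasure μ u (φ ⁻¹' {y}) < ∞) {f : Lp ℂ 2 μ} :
    f ∈ (opRange (weightedComp μ φ u h))ᗮ ↔
      ∀ y, 0 < μ {y} → ∫ x in φ ⁻¹' {y}, f x * starRingEnd ℂ (u x) ∂μ = 0 := by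
  have hφ : ∀ᵐ x ∂μ, 0 < μ {φ x} := hμ.ae_iff.2 fun x hx => hμ.atom_map h hx (hu x)
  rw [Submodule.mem_orthogonal]
  constructor
  · intro hf y hy
    have hae : (fun x => u x * hμ.point y (φ x)) =ᵐ[μ] (φ ⁻¹' {y}).indicator u := by
      filter_upwards [h.ae (hμ.point_ae y)] with x hx
      rw [hx (hu x)]
      by_cases hxy : φ x = y <;> simp [hxy]
    have hd : hμ.point y ∈ (weightedComp μ φ u h).domain := by
      rw [mem_domain_weightedComp, memLp_congr_ae hae,
        memLp_two_iff_lintegral (hμ.measurable _).aestronglyMeasurable]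
      have := hfin y hy
      rw [hμ.weightedMeasure_apply, ← lintegral_indicator (hμ.measurableSet_all _)] at this
      refine lt_of_le_of_lt (le_of_eq (lintegral_congr fun x => ?_)) this
      by_cases hxy : φ x = y <;> simp [hxy]
    have := hf _ (apply_mem_opRange _ ⟨_, hd⟩)
    rw [L2.inner_def] at this
    rw [← integral_indicator (hμ.measurableSet_all _), ← this]
    refine integral_congr_ae ?_
    filter_upwards [coeFn_weightedComp h ⟨_, hd⟩, hae] with x hx hx'
    rw [hx, hx', RCLike.inner_apply]
    by_cases hxy : φ x = y <;> simp [hxy]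
  · rintro hf _ ⟨g, rfl⟩
    rw [L2.inner_def]
    refine hμ.integral_eq_zero_of_fiber hφ (L2.integrable_inner _ _) fun y hy => ?_
    have : ∀ᵐ x ∂μ, x ∈ φ ⁻¹' {y} →
        inner ℂ ((weightedComp μ φ u h).toFun g x) (f x) =
          starRingEnd ℂ ((g : Lp ℂ 2 μ) y) * (f x * starRingEnd ℂ (u x)) := by
      filter_upwards [coeFn_weightedComp h g] with x hx hxy
      have hxy' : φ x = y := hxy
      change inner ℂ (weightedComp μ φ u h g x) (f x) = _
      rw [hx, hxy', RCLike.inner_apply, map_mul]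
      ring
    rw [setIntegral_congr_ae (hμ.measurableSet_all _) this, integral_const_mul, hf y hy, mul_zero]

theorem orthogonal_opKer_mulOp (hμ : IsDiscreteMeasureSpace μ) (hu : ∀ x, u x ≠ 0) :
    (opKer (mulOp μ u (hμ.measurable u)))ᗮ = ⊤ := by
  rw [Submodule.orthogonal_eq_top_iff, eq_bot_iff]
  intro f hf
  rw [mulOp, mem_opKer_weightedComp] at hf
  refine Lp.ext ?_
  filter_upwards [hf, Lp.coeFn_zero ℂ 2 μ] with x hx h0
  rw [h0]
  exact (mul_eq_zero.1 hx).resolve_left (hu x)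

theorem orthogonal_opRange_mulOp (hμ : IsDiscreteMeasureSpace μ) (hu : ∀ x, u x ≠ 0) :
    (opRange (mulOp μ u (hμ.measurable u)))ᗮ = ⊥ := by
  have : MeasurableSingletonClass X := ⟨fun _ => hμ.measurableSet_all _⟩
  rw [eq_bot_iff]
  intro f hf
  rw [mulOp, hμ.mem_orthogonal_opRange_weightedComp _ hu fun y _ => ?_] at hf
  · refine Lp.ext (hμ.ae_iff.2 fun y hy => ?_)
    have := hf y hy
    rw [Set.preimage_id, integral_singleton, smul_eq_zero, mul_eq_zero] at this
    rw [hμ.ae_iff.1 (Lp.coeFn_zero ℂ 2 μ) y hy]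
    rcases this with h | h | h
    · exact absurd h (ENNReal.toReal_pos hy.ne' (hμ.measure_singleton_lt_top y).ne).ne'
    · exact h
    · exact absurd ((map_eq_zero _).1 h) (hu y)
  · rw [hμ.weightedMeasure_apply, Set.preimage_id, lintegral_singleton]
    exact ENNReal.mul_lt_top (by simp) (hμ.measure_singleton_lt_top y)

/-- A nowhere vanishing `u` makes `M_u` injective with dense range, so its reciprocal is the plain
inverse. -/
theorem mem_graph_reciprocal_mulOp (hμ : IsDiscreteMeasureSpace μ) (hu : ∀ x, u x ≠ 0)
    {f k : Lp ℂ 2 μ} :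
    (f, k) ∈ (reciprocal (mulOp μ u (hμ.measurable u))).graph ↔
      f =ᵐ[μ] fun x => u x * k x := by
  rw [mem_graph_reciprocal, hμ.orthogonal_opKer_mulOp hu, hμ.orthogonal_opRange_mulOp hu]
  constructor
  · rintro ⟨hk, -, hf⟩
    rw [Submodule.mem_bot, sub_eq_zero] at hf
    rw [hf]
    exact coeFn_weightedComp _ ⟨k, hk⟩
  · intro hf
    have hk : k ∈ (mulOp μ u (hμ.measurable u)).domain := (memLp_congr_ae hf).1 (Lp.memLp f)
    refine ⟨hk, trivial, ?_⟩
    rw [Submodule.mem_bot, sub_eq_zero]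
    exact Lp.ext (hf.trans (coeFn_weightedComp (isWellDefined_id μ (hμ.measurable u)) ⟨k, hk⟩).symm)

end IsDiscreteMeasureSpace

end WeightedComposition

/-! ### Weights of constant modulus on the fibres -/

namespace WeightedComposition

namespace IsDiscreteMeasureSpace

variable {X : Type*} [MeasurableSpace X] {μ : Measure X} {φ : X → X} {w : X → ℂ}

/-- A weight fixed by the conditional expectation `E_φ` has constant modulus on the fibres. -/
theorem exists_norm_eq_comp
    (hE : condExpect μ φ 1 (fun x => ‖w x‖ₑ ^ 2) =ᵐ[μ] fun x => ‖w x‖ₑ ^ 2) :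
    ∃ c : X → ℝ, ∀ᵐ x ∂μ, ‖w x‖ = c (φ x) := by
  -- Doob–Dynkin: a function measurable for `φ⁻¹(𝒜)` factors through `φ`.
  obtain ⟨g, -, hg⟩ := Measurable.exists_eq_measurable_comp
    (measurable_condLExp (MeasurableSpace.comap φ inferInstance) (weightedMeasure μ 1)
      fun x => ‖w x‖ₑ ^ 2)
  refine ⟨fun y => √(g y).toReal, ?_⟩
  filter_upwards [hE] with x hx
  rw [condExpect, hg, Function.comp_apply] at hx
  rw [hx, ENNReal.toReal_pow, toReal_enorm, Real.sqrt_sq (norm_nonneg _)]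

theorem rn_eq_mul_rn_one (hμ : IsDiscreteMeasureSpace μ) (h1 : μ.map φ ≪ μ) {c : X → ℝ}
    (hc : ∀ᵐ x ∂μ, ‖w x‖ = c (φ x)) {y : X} (hy : 0 < μ {y}) :
    rn μ φ w y = ‖c y‖ₑ ^ 2 * rn μ φ 1 y := by
  refine (ENNReal.mul_left_inj hy.ne' (hμ.measure_singleton_lt_top y).ne).1 ?_
  rw [mul_assoc, hμ.rn_mul_measure h1, hμ.rn_mul_measure h1,
    ← lintegral_const_mul _ (hμ.measurable _)]
  refine setLIntegral_congr_fun_ae (hμ.measurableSet_all _) ?_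
  filter_upwards [hc] with x hx hxy
  have hxy' : φ x = y := hxy
  rw [hxy'] at hx
  simp [← hx]

theorem rn_one_mul_measure (hμ : IsDiscreteMeasureSpace μ) (h1 : μ.map φ ≪ μ) (y : X) :
    rn μ φ 1 y * μ {y} = μ (φ ⁻¹' {y}) := by
  rw [hμ.rn_mul_measure h1]; simp

/-- Here `|ŵ| = |w| / (|w|² · h_φ ∘ φ)`. The value `h_φ (φ x)` is positive because the fibre
contains the atom `x`, and finite because the fibre has finite measure, so passing to real numbers
loses nothing. -/
theorem norm_hatWeight_eq_inv_mul (hμ : IsDiscreteMeasureSpace μ) (hw0 : ∀ x, w x ≠ 0)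
    (h1 : IsWellDefined μ φ 1)
    (hfin : ∀ y, 0 < μ {y} → μ (φ ⁻¹' {y}) < ∞) {c : X → ℝ}
    (hc : ∀ᵐ x ∂μ, ‖w x‖ = c (φ x)) {x : X} (hx : 0 < μ {x}) :
    0 < ‖hatWeight μ φ 1 x‖ ∧ ‖hatWeight μ φ w x‖ = ‖w x‖⁻¹ * ‖hatWeight μ φ 1 x‖ := by
  have hac : μ.map φ ≪ μ := by simpa only [weightedMeasure_one] using h1.absolutelyContinuous
  have hy : 0 < μ {φ x} := hμ.atom_map h1 hx one_ne_zero
  have hp := hμ.rn_one_mul_measure hac (φ x)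
  have hm : 0 < μ (φ ⁻¹' {φ x}) := hx.trans_le (measure_mono (by simp))
  have hp0 : rn μ φ 1 (φ x) ≠ 0 := fun h => by rw [h, zero_mul] at hp; exact hm.ne hp
  have hpt : rn μ φ 1 (φ x) ≠ ∞ := fun h => by
    rw [h, ENNReal.top_mul hy.ne'] at hp; exact (hfin _ hy).ne hp.symm
  have hpos := ENNReal.toReal_pos hp0 hpt
  have hcx := hμ.ae_iff.1 hc x hx
  have hwx : 0 < ‖w x‖ := norm_pos_iff.2 (hw0 x)
  have hq : (rn μ φ w (φ x)).toReal = ‖w x‖ ^ 2 * (rn μ φ 1 (φ x)).toReal := by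
    rw [hμ.rn_eq_mul_rn_one hac hc hy, ENNReal.toReal_mul, ENNReal.toReal_pow, toReal_enorm,
      ← hcx, norm_norm]
  have e1 : ‖hatWeight μ φ 1 x‖ = (rn μ φ 1 (φ x)).toReal⁻¹ := by
    rw [hatWeight, norm_div, Complex.norm_of_nonneg hpos.le]; simp
  have e2 : ‖hatWeight μ φ w x‖ = ‖w x‖ / (rn μ φ w (φ x)).toReal := by
    rw [hatWeight, norm_div, Complex.norm_of_nonneg ENNReal.toReal_nonneg]
  rw [e2, e1, hq]
  exact ⟨inv_pos.2 hpos, by field_simp⟩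

theorem bounded_below_iff_rn_le (hμ : IsDiscreteMeasureSpace μ) (hw0 : ∀ x, w x ≠ 0)
    (h1 : IsWellDefined μ φ 1)
    (hfin : ∀ y, 0 < μ {y} → μ (φ ⁻¹' {y}) < ∞) {c : X → ℝ}
    (hc : ∀ᵐ x ∂μ, ‖w x‖ = c (φ x)) :
    (∃ α : ℝ, 0 < α ∧ ∀ᵐ x ∂μ, α < ‖w x‖) ↔
      ∃ β : ℝ, 0 < β ∧ ∀ᵐ x ∂μ,
        rn μ φ (hatWeight μ φ w) x ≤ ENNReal.ofReal β * rn μ φ (hatWeight μ φ 1) x := by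
  have hac : μ.map φ ≪ μ := by simpa only [weightedMeasure_one] using h1.absolutelyContinuous
  have hsq : ∀ (t : ℝ) (z : ℂ), 0 ≤ t →
      ENNReal.ofReal t * ‖z‖ₑ ^ 2 = ENNReal.ofReal (t * ‖z‖ ^ 2) := fun t z ht => by
    rw [ENNReal.ofReal_mul ht, ENNReal.ofReal_pow (norm_nonneg _), ofReal_norm]
  have hle : ∀ (β : ℝ) (y : X), 0 < μ {y} →
      (rn μ φ (hatWeight μ φ w) y ≤ ENNReal.ofReal β * rn μ φ (hatWeight μ φ 1) y ↔
        ∫⁻ x in φ ⁻¹' {y}, ‖hatWeight μ φ w x‖ₑ ^ 2 ∂μ ≤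
          ∫⁻ x in φ ⁻¹' {y}, ENNReal.ofReal β * ‖hatWeight μ φ 1 x‖ₑ ^ 2 ∂μ) := by
    intro β y hy
    rw [lintegral_const_mul _ (hμ.measurable _), ← hμ.rn_mul_measure hac,
      ← hμ.rn_mul_measure hac, ← mul_assoc,
      ENNReal.mul_le_mul_iff_left hy.ne' (hμ.measure_singleton_lt_top y).ne]
  have key := fun x (hx : 0 < μ {x}) => hμ.norm_hatWeight_eq_inv_mul hw0 h1 hfin hc hx
  constructor
  · rintro ⟨α, hα, h⟩
    refine ⟨(α⁻¹) ^ 2, by positivity, hμ.ae_iff.2 fun y hy => (hle _ y hy).2 ?_⟩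
    refine lintegral_mono_ae (ae_restrict_of_ae (hμ.ae_iff.2 fun x hx => ?_))
    rw [hsq _ _ (by positivity), ← one_mul (‖_‖ₑ ^ 2), ← ENNReal.ofReal_one,
      hsq _ _ zero_le_one, one_mul, (key x hx).2, mul_pow]
    have := (hμ.ae_iff.1 h x hx).le
    gcongr
  · rintro ⟨β, hβ, h⟩
    -- The fibre comparison gives only `|w|⁻¹ ≤ √β`; the factor 2 makes the required inequality
    -- strict.
    refine ⟨(2 * √β)⁻¹, by positivity, hμ.ae_iff.2 fun x hx => ?_⟩
    have hy : 0 < μ {φ x} := hμ.atom_map h1 hx one_ne_zero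
    have hm : 0 < μ (φ ⁻¹' {φ x}) := hx.trans_le (measure_mono (by simp))
    have h2 := (hle β _ hy).1 (hμ.ae_iff.1 h _ hy)
    -- Both integrands are constant on the fibre of `x`, so its positive finite measure cancels and
    -- a pointwise inequality at `x` remains.
    have hconst : ∀ᵐ z ∂μ, z ∈ φ ⁻¹' {φ x} →
        ‖hatWeight μ φ w z‖ₑ ^ 2 = ‖hatWeight μ φ w x‖ₑ ^ 2 ∧
          ENNReal.ofReal β * ‖hatWeight μ φ 1 z‖ₑ ^ 2 =
            ENNReal.ofReal β * ‖hatWeight μ φ 1 x‖ₑ ^ 2 := by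
      refine hμ.ae_iff.2 fun z hz hzx => ?_
      have hzx' : φ z = φ x := hzx
      have e : ‖hatWeight μ φ 1 z‖ = ‖hatWeight μ φ 1 x‖ := by simp [hatWeight, hzx']
      have e' : ‖hatWeight μ φ w z‖ = ‖hatWeight μ φ w x‖ := by
        rw [(key z hz).2, (key x hx).2, e, hμ.ae_iff.1 hc z hz, hμ.ae_iff.1 hc x hx, hzx']
      simp only [← ofReal_norm, e, e', and_self]
    rw [setLIntegral_congr_fun_ae (hμ.measurableSet_all _) (hconst.mono fun z hz h => (hz h).1),
      setLIntegral_congr_fun_ae (hμ.measurableSet_all _) (hconst.mono fun z hz h => (hz h).2),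
      setLIntegral_const, setLIntegral_const,
      ENNReal.mul_le_mul_iff_left hm.ne' (hfin _ hy).ne, hsq _ _ hβ.le, ← ofReal_norm,
      ← ENNReal.ofReal_pow (norm_nonneg _), ENNReal.ofReal_le_ofReal_iff (by positivity),
      (key x hx).2, mul_pow, mul_le_mul_iff_left₀ (pow_pos (key x hx).1 2)] at h2
    have hwx : 0 < ‖w x‖ := norm_pos_iff.2 (hw0 x)
    have h3 : ‖w x‖⁻¹ ≤ √β := Real.le_sqrt_of_sq_le h2
    have hs : 0 < √β := Real.sqrt_pos.2 hβ
    rw [inv_lt_comm₀ (by positivity) hwx]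
    linarith

/-- The formulas always agree; only the domains need the lower bound, which gives `|g ∘ φ| ≤ α⁻¹ |w
· (g ∘ φ)|` and so places `g` in the domain of `C_φ`. -/
theorem opMul_mulOp_weightedComp (hμ : IsDiscreteMeasureSpace μ)
    (h1 : IsWellDefined μ φ 1) (hw : IsWellDefined μ φ w) {α : ℝ} (hα : 0 < α)
    (h : ∀ᵐ x ∂μ, α < ‖w x‖) :
    opMul (mulOp μ w (hμ.measurable w)) (weightedComp μ φ 1 h1) = weightedComp μ φ w hw := by
  have hcomp : ∀ g (hg : g ∈ (weightedComp μ φ 1 h1).domain),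
      (fun x => w x * weightedComp μ φ 1 h1 ⟨g, hg⟩ x) =ᵐ[μ] fun x => w x * g (φ x) := by
    intro g hg
    filter_upwards [coeFn_weightedComp h1 ⟨g, hg⟩] with x hx
    rw [hx, Pi.one_apply, one_mul]
  refine LinearPMap.ext (Submodule.ext fun g => ⟨?_, fun hg => ?_⟩) fun g hf hg => ?_
  · rintro ⟨hg, hg'⟩
    exact (memLp_congr_ae (hcomp g hg)).1 hg'
  · have hg1 : g ∈ (weightedComp μ φ 1 h1).domain := by
      refine MemLp.of_le_mul (c := α⁻¹) ((mem_domain_weightedComp hw g).1 hg)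
        (hμ.measurable _).aestronglyMeasurable ?_
      filter_upwards [h] with x hx
      rw [Pi.one_apply, one_mul, norm_mul, ← mul_assoc]
      refine le_mul_of_one_le_left (norm_nonneg _) ?_
      rw [inv_mul_eq_div, one_le_div hα]
      exact hx.le
    exact ⟨hg1, (memLp_congr_ae (hcomp g hg1)).2 hg⟩
  · obtain ⟨hg1, hg2⟩ := hf
    refine Lp.ext ?_
    exact ((coeFn_weightedComp (isWellDefined_id μ (hμ.measurable w)) ⟨_, hg2⟩).trans
      (hcomp g hg1)).trans (coeFn_weightedComp hw ⟨g, hg⟩).symm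

/-- Functions orthogonal to the range of `C_φ` correspond to those orthogonal to the range of
`C_{φ,w}` under multiplication by a weight of modulus constant on the fibres. -/
theorem mem_orthogonal_opRange_iff (hμ : IsDiscreteMeasureSpace μ) (hw0 : ∀ x, w x ≠ 0)
    (h1 : IsWellDefined μ φ 1) (hw : IsWellDefined μ φ w)
    (hfin : ∀ y, 0 < μ {y} → weightedMeasure μ 1 (φ ⁻¹' {y}) < ∞)
    (hfinw : ∀ y, 0 < μ {y} → weightedMeasure μ w (φ ⁻¹' {y}) < ∞) {c : X → ℝ}
    (hc : ∀ᵐ x ∂μ, ‖w x‖ = c (φ x)) {f k : Lp ℂ 2 μ} (hfk : f =ᵐ[μ] fun x => w x * k x) :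
    f ∈ (opRange (weightedComp μ φ w hw))ᗮ ↔ k ∈ (opRange (weightedComp μ φ 1 h1))ᗮ := by
  rw [hμ.mem_orthogonal_opRange_weightedComp hw hw0 hfinw,
    hμ.mem_orthogonal_opRange_weightedComp h1 (fun _ => one_ne_zero) hfin]
  refine forall₂_congr fun y hy => ?_
  have e : ∫ x in φ ⁻¹' {y}, f x * starRingEnd ℂ (w x) ∂μ =
      (c y : ℂ) ^ 2 * ∫ x in φ ⁻¹' {y}, k x * starRingEnd ℂ ((1 : X → ℂ) x) ∂μ := by
    rw [← integral_const_mul]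
    refine setIntegral_congr_ae (hμ.measurableSet_all _) ?_
    filter_upwards [hfk, hc] with x hx hcx hxy
    have hxy' : φ x = y := hxy
    rw [hxy'] at hcx
    rw [hx, ← hcx, ← Complex.mul_conj', Pi.one_apply, map_one]
    ring
  -- The factor `c(y)²` can vanish only if the fibre is null, since `w` has no zeros; the integral
  -- of `k` is then zero anyway.
  rw [e, mul_eq_zero, or_iff_right_iff_imp]
  intro h0
  refine setIntegral_eq_zero_of_ae_eq_zero (hμ.ae_iff.2 fun x hx hxy => ?_)
  have hxy' : φ x = y := hxy
  have := hμ.ae_iff.1 hc x hx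
  rw [hxy', Complex.ofReal_eq_zero.1 (pow_eq_zero_iff two_ne_zero |>.1 h0)] at this
  exact absurd (norm_eq_zero.1 this) (hw0 x)

/-- If `g ∘ φ` is the conditional expectation of `k` and `w • k` is square integrable, then so is
`w • (g ∘ φ)`. -/
theorem mem_domain_of_sub_mem_orthogonal (hμ : IsDiscreteMeasureSpace μ)
    (h1 : IsWellDefined μ φ 1) (hw : IsWellDefined μ φ w)
    (hfin : ∀ y, 0 < μ {y} → weightedMeasure μ 1 (φ ⁻¹' {y}) < ∞) {c : X → ℝ}
    (hc : ∀ᵐ x ∂μ, ‖w x‖ = c (φ x)) {g k : Lp ℂ 2 μ}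
    (hg : g ∈ (weightedComp μ φ 1 h1).domain)
    (hkg : k - weightedComp μ φ 1 h1 ⟨g, hg⟩ ∈ (opRange (weightedComp μ φ 1 h1))ᗮ)
    (hk : MemLp (fun x => w x * k x) 2 μ) :
    g ∈ (weightedComp μ φ w hw).domain := by
  have hφ : ∀ᵐ x ∂μ, 0 < μ {φ x} := hμ.ae_iff.2 fun x hx => hμ.atom_map h1 hx one_ne_zero
  rw [mem_domain_weightedComp, memLp_two_iff_lintegral (hμ.measurable _).aestronglyMeasurable]
  refine lt_of_le_of_lt ?_
    ((memLp_two_iff_lintegral (hμ.measurable _).aestronglyMeasurable).1 hk)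
  rw [hμ.lintegral_eq_tsum_fiber hφ, hμ.lintegral_eq_tsum_fiber hφ (fun x => ‖w x * k x‖ₑ ^ 2)]
  refine ENNReal.tsum_le_tsum fun ⟨y, hy⟩ => ?_
  rw [hμ.mem_orthogonal_opRange_weightedComp h1 (fun _ => one_ne_zero) hfin] at hkg
  have : IsFiniteMeasure (μ.restrict (φ ⁻¹' {y})) := by
    refine ⟨?_⟩
    rw [Measure.restrict_apply_univ]
    simpa only [weightedMeasure_one] using hfin y hy
  -- Orthogonality to the range of `C_φ` says that `g y` is the mean of `k` over the fibre, if the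
  -- fibre is not null.
  have hmean : ∫ x in φ ⁻¹' {y}, (k x - g y) ∂μ = 0 := by
    rw [← hkg y hy]
    refine setIntegral_congr_ae (hμ.measurableSet_all _) ?_
    filter_upwards [Lp.coeFn_sub k (weightedComp μ φ 1 h1 ⟨g, hg⟩),
      coeFn_weightedComp h1 ⟨g, hg⟩] with x hx hx' hxy
    have hxy' : φ x = y := hxy
    rw [hx, Pi.sub_apply, hx', hxy']
    simp
  have hle := lintegral_const_le_of_integral_sub_eq_zero ((Lp.memLp k).restrict _) hmean
  -- The weight contributes the same constant to both sides, leaving the unweighted mean inequality.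
  have hfib : ∀ F : X → ℂ, ∫⁻ x in φ ⁻¹' {y}, ‖w x * F x‖ₑ ^ 2 ∂μ =
      ‖c y‖ₑ ^ 2 * ∫⁻ x in φ ⁻¹' {y}, ‖F x‖ₑ ^ 2 ∂μ := by
    intro F
    rw [← lintegral_const_mul _ (hμ.measurable _)]
    refine setLIntegral_congr_fun_ae (hμ.measurableSet_all _) ?_
    filter_upwards [hc] with x hx hxy
    have hxy' : φ x = y := hxy
    rw [hxy'] at hx
    rw [enorm_mul, mul_pow, ← hx, enorm_norm]
  change ∫⁻ x in φ ⁻¹' {y}, _ ∂μ ≤ ∫⁻ x in φ ⁻¹' {y}, _ ∂μ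
  rw [hfib fun x => g (φ x), hfib k]
  refine mul_le_mul_right (le_trans (le_of_eq ?_) hle) _
  refine setLIntegral_congr_fun (hμ.measurableSet_all _) fun x hxy => ?_
  have hxy' : φ x = y := hxy
  simp only [hxy']

theorem reciprocal_weightedComp_eq_opMul (hμ : IsDiscreteMeasureSpace μ) (hw0 : ∀ x, w x ≠ 0)
    (h1 : IsWellDefined μ φ 1) (hw : IsWellDefined μ φ w)
    (hfin : ∀ y, 0 < μ {y} → weightedMeasure μ 1 (φ ⁻¹' {y}) < ∞)
    (hfinw : ∀ y, 0 < μ {y} → weightedMeasure μ w (φ ⁻¹' {y}) < ∞) {c : X → ℝ}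
    (hc : ∀ᵐ x ∂μ, ‖w x‖ = c (φ x)) {α : ℝ} (hα : 0 < α) (h : ∀ᵐ x ∂μ, α < ‖w x‖) :
    reciprocal (weightedComp μ φ w hw) =
      opMul (reciprocal (weightedComp μ φ 1 h1)) (reciprocal (mulOp μ w (hμ.measurable w))) := by
  have hker : opKer (weightedComp μ φ w hw) = opKer (weightedComp μ φ 1 h1) := by
    ext g
    simp only [mem_opKer_weightedComp, mul_eq_zero, hw0, false_or, Pi.one_apply, one_ne_zero]
  -- When `f = w k`, the defect `f - w · (g ∘ φ)` is `w` times the defect `k - g ∘ φ`.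
  have hsub : ∀ {f k g : Lp ℂ 2 μ} (hgw : g ∈ (weightedComp μ φ w hw).domain)
      (hg1 : g ∈ (weightedComp μ φ 1 h1).domain), (f =ᵐ[μ] fun x => w x * k x) →
      (f - weightedComp μ φ w hw ⟨g, hgw⟩ ∈ (opRange (weightedComp μ φ w hw))ᗮ ↔
        k - weightedComp μ φ 1 h1 ⟨g, hg1⟩ ∈ (opRange (weightedComp μ φ 1 h1))ᗮ) := by
    intro f k g hgw hg1 hfk
    refine hμ.mem_orthogonal_opRange_iff hw0 h1 hw hfin hfinw hc ?_
    filter_upwards [hfk, Lp.coeFn_sub f (weightedComp μ φ w hw ⟨g, hgw⟩),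
      Lp.coeFn_sub k (weightedComp μ φ 1 h1 ⟨g, hg1⟩), coeFn_weightedComp hw ⟨g, hgw⟩,
      coeFn_weightedComp h1 ⟨g, hg1⟩] with x e1 e2 e3 e4 e5
    rw [e2, e3, Pi.sub_apply, Pi.sub_apply, e1, e4, e5, Pi.one_apply]
    ring
  refine LinearPMap.eq_of_eq_graph (Submodule.ext ?_)
  rintro ⟨f, g⟩
  rw [mem_graph_opMul]
  simp only [hμ.mem_graph_reciprocal_mulOp hw0]
  rw [mem_graph_reciprocal, hker]
  constructor
  · rintro ⟨hgw, hgk, hgo⟩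
    -- The intermediate vector of the product is `k = f / w`, square integrable because `|w|⁻¹ ≤
    -- α⁻¹`.
    have hkL : MemLp (fun x => (w x)⁻¹ * f x) 2 μ := by
      refine MemLp.of_le_mul (c := α⁻¹) (Lp.memLp f) (hμ.measurable _).aestronglyMeasurable ?_
      filter_upwards [h] with x hx
      rw [norm_mul, norm_inv]
      gcongr
    have hfk : f =ᵐ[μ] fun x => w x * (hkL.toLp : X → ℂ) x := by
      filter_upwards [hkL.coeFn_toLp] with x hx
      rw [hx, mul_inv_cancel_left₀ (hw0 x)]
    have hg1 : g ∈ (weightedComp μ φ 1 h1).domain := by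
      have hgw' := hgw
      rw [← hμ.opMul_mulOp_weightedComp h1 hw hα h] at hgw'
      exact hgw'.1
    exact ⟨hkL.toLp, hfk, mem_graph_reciprocal.2 ⟨hg1, hgk, (hsub hgw hg1 hfk).1 hgo⟩⟩
  · rintro ⟨k, hfk, hk⟩
    obtain ⟨hg1, hgk, hgo⟩ := mem_graph_reciprocal.1 hk
    have hgw := hμ.mem_domain_of_sub_mem_orthogonal h1 hw hfin hc hg1 hgo
      ((memLp_congr_ae hfk).1 (Lp.memLp f))
    exact ⟨hgw, hgk, (hsub hgw hg1 hfk).2 hgo⟩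

end IsDiscreteMeasureSpace

end WeightedComposition

open WeightedComposition in
theorem proposition23 {X : Type*} [MeasurableSpace X] (μ : Measure X)
    (hμ : IsDiscreteMeasureSpace μ) (φ : X → X) (w : X → ℂ) (hw0 : ∀ x, w x ≠ 0)
    (h1 : IsWellDefined μ φ 1) (hw : IsWellDefined μ φ w)
    (hd1 : Dense ((weightedComp μ φ 1 h1).domain : Set (Lp ℂ 2 μ)))
    (hdw : Dense ((weightedComp μ φ w hw).domain : Set (Lp ℂ 2 μ)))
    (hE : condExpect μ φ 1 (fun x => ‖w x‖ₑ ^ 2) =ᵐ[μ] fun x => ‖w x‖ₑ ^ 2) :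
    ((∃ α : ℝ, 0 < α ∧ ∀ᵐ x ∂μ, α < ‖w x‖) ↔
      ∃ β : ℝ, 0 < β ∧ ∀ᵐ x ∂μ,
        rn μ φ (hatWeight μ φ w) x ≤ ENNReal.ofReal β * rn μ φ (hatWeight μ φ 1) x) ∧
    (((∃ α : ℝ, 0 < α ∧ ∀ᵐ x ∂μ, α < ‖w x‖) ∨
      ∃ β : ℝ, 0 < β ∧ ∀ᵐ x ∂μ,
        rn μ φ (hatWeight μ φ w) x ≤ ENNReal.ofReal β * rn μ φ (hatWeight μ φ 1) x) →
      HasReciprocal (opMul (mulOp μ w hw.measurable_weight) (weightedComp μ φ 1 h1)) ∧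
      HasReciprocal (weightedComp μ φ 1 h1) ∧
      HasReciprocal (mulOp μ w hw.measurable_weight) ∧
      reciprocal (opMul (mulOp μ w hw.measurable_weight) (weightedComp μ φ 1 h1)) =
        opMul (reciprocal (weightedComp μ φ 1 h1))
          (reciprocal (mulOp μ w hw.measurable_weight))) := by
  have hfin := fun y hy => hμ.weightedMeasure_fiber_lt_top h1 hd1 (y := y) hy
  have hfinw := fun y hy => hμ.weightedMeasure_fiber_lt_top hw hdw (y := y) hy
  obtain ⟨c, hc⟩ := IsDiscreteMeasureSpace.exists_norm_eq_comp hE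
  have hiff := hμ.bounded_below_iff_rn_le hw0 h1
    (by simpa only [weightedMeasure_one] using hfin) hc
  refine ⟨hiff, fun h => ?_⟩
  obtain ⟨α, hα, hαw⟩ := h.elim id hiff.2
  rw [hμ.opMul_mulOp_weightedComp h1 hw hα hαw]
  exact ⟨hμ.hasReciprocal_weightedComp hw, hμ.hasReciprocal_weightedComp h1,
    hμ.hasReciprocal_weightedComp _,
    hμ.reciprocal_weightedComp_eq_opMul hw0 h1 hw hfin hfinw hc hα hαw⟩
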